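/- Let $\mathbb{F}_d$ be the free group of finite rank $d \ge 2$ and let $\partial\mathbb{F}_d$ be its Gromov boundary, i.e. the compact space of infinite reduced words, on which $\mathbb{F}_d$ acts by left multiplication; for $1 \ne t \in \mathbb{F}_d$ put $t^{\infty} = \lim_n t^n$ and $t^{-\infty} = (t^{-1})^{\infty}$ in $\partial\mathbb{F}_d$. Let $\Gamma$ be a non-trivial normal subgroup of $\mathbb{F}_d$, and for $t\in\mathbb{F}_d$ and a subgroup $\Lambda \le \mathbb{F}_d$ let $C_\Lambda(t) = \{gtg^{-1} \mid g \in \Lambda\}$. Let $T$ be a subset of $\mathbb{F}_d$ such that 1. every $t \in T$ is indivisible, i.e. not of the form $h^n$ with $h \in \mathbb{F}_d$ and $n \ge 2$; 2. the set $\{C_{\mathbb{F}_d}(t) \mid t \in T\}$ is finite; 3. $t^n \notin \Gamma$ for every $t \in T$ and every non-zero integer $n$; 4. $C_\Gamma(s) \cap \{t, t^{-1}\} = \emptyset$ for all distinct $s, t \in T$. For $S \subseteq T$ let $$\mathcal{R}_{S,\Gamma} = \{(x,x) \mid x \in \partial\mathbb{F}_d\} \cup \{(g.t^{\infty}, g.t^{-\infty})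 \mid g \in \Gamma,\ t \in S \cup S^{-1}\}.$$ Then, for every $S \subseteq T$, $\mathcal{R}_{S,\Gamma}$ is a $\Gamma$-invariant equivalence relation on $\partial\mathbb{F}_d$ with Hausdorff quotient. Let $\rho_S \colon \partial\mathbb{F}_d \to \partial\mathbb{F}_d/\mathcal{R}_{S,\Gamma}$ be the quotient map and put $\pi = \rho_T$. A $\Gamma$-space is a locally compact Hausdorff space with an action of $\Gamma$ by homeomorphisms, and a factor map is a $\Gamma$-equivariant topological quotient map. An intermediate extension of $\pi$ is a $\Gamma$-space $Z$ with factor maps $\rho \colon \partial\mathbb{F}_d \to Z$ and $\rho' \colon Z \to \partial\mathbb{F}_d/\mathcal{R}_{T,\Gamma}$ such that $\rho' \circ \rho = \pi$; two of them are identified if there is a $\Gamma$-equivariant homeomorphism between the spaces $Z$ that is compatible with the maps $\rho$ and $\rho'$. Then the map $$(\rho \colon \partial\mathbb{F}_d \to Z) \mapsto S_\rho = \{t \in T \mid |\rho^{-1}(\rho(t^{\infty}))| = 2\}$$ is a bijection from the set of (isomorphism classes of) intermediate extensions of $\pi$ onto the set of subsets of $T$, and its inverse is $S \mapsto (\rho_S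 \colon \partial\mathbb{F}_d \to \partial\mathbb{F}_d/\mathcal{R}_{S,\Gamma})$. -/

import Mathlib

open Filter Topology Pointwise

namespace FreeGroupBoundary

universe u

/-- A letter of the alphabet `S ∪ S⁻¹`; `(a, true)` stands for `a` and `(a, false)` for `a⁻¹`,
as in `FreeGroup`. -/
abbrev Letter (α : Type u) : Type u := α × Bool

/-- The formal inverse of a letter. -/
def Letter.inv {α : Type u} (l : Letter α) : Letter α := (l.1, !l.2)

theorem Letter.inv_inv {α : Type u} (l : Letter α) : Letter.inv (Letter.inv l) = l := by
  simp [Letter.inv]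

/-- The Gromov boundary of the free group on `α`: the infinite reduced words
`x₀ x₁ x₂ ⋯` in the letters `a^{±1}`. -/
def Boundary (α : Type u) : Type u :=
  {w : ℕ → Letter α // ∀ n, w (n + 1) ≠ Letter.inv (w n)}

/-- The topology of pointwise (letter by letter) convergence: the subspace topology of the product
of the discrete spaces of letters. -/
instance (α : Type u) : TopologicalSpace (Boundary α) :=
  TopologicalSpace.induced Subtype.val
    (@Pi.topologicalSpace ℕ (fun _ => Letter α) (fun _ => ⊥))

namespace Boundary

variable {α : Type u}

theorem ext {x y : Boundary α} (h : ∀ n, x.1 n = y.1 n) : x = y := Subtype.ext (funext h)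

instance [Nonempty α] : Nonempty (Boundary α) :=
  ⟨⟨fun _ => (Classical.arbitrary α, true), fun _ h => by simp [Letter.inv] at h⟩⟩

/-- Remove the first letter. -/
def tail (w : Boundary α) : Boundary α := ⟨fun n => w.1 (n + 1), fun n => w.2 (n + 1)⟩

/-- Put the letter `l` in front of a word that does not start with `l⁻¹`. -/
def cons (l : Letter α) (w : Boundary α) (h : w.1 0 ≠ Letter.inv l) : Boundary α :=
  ⟨fun n => Nat.casesOn n l w.1, fun n => by
    cases n with
    | zero => exact h
    | succ n => exact w.2 n⟩

open Classical in
/-- Left multiplication of an infinite reduced word by a letter, followed by reduction. -/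
noncomputable def letterAct (l : Letter α) (w : Boundary α) : Boundary α :=
  if h : w.1 0 = Letter.inv l then tail w else cons l w h

theorem letterAct_inv_letterAct (l : Letter α) (w : Boundary α) :
    letterAct (Letter.inv l) (letterAct l w) = w := by
  by_cases h : w.1 0 = Letter.inv l
  · have h1 : (tail w).1 0 ≠ Letter.inv (Letter.inv l) := by
      have := w.2 0
      rw [h] at this
      exact this
    rw [letterAct, letterAct, dif_pos h, dif_neg h1]
    apply ext
    intro n
    cases n with
    | zero => exact h.symm
    | succ n => rfl
  · have h1 : (cons l w h).1 0 = Letter.inv (Letter.inv l) := (Letter.inv_inv l).symm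
    rw [letterAct, letterAct, dif_neg h, dif_pos h1]
    rfl

theorem continuous_coord_comp (n : ℕ) {β : Type*} (f : Letter α → β) :
    @Continuous _ _ _ ⊥ (fun w : Boundary α => f (w.1 n)) := by
  let _ : TopologicalSpace (Letter α) := ⊥
  have : DiscreteTopology (Letter α) := ⟨rfl⟩
  let _ : TopologicalSpace β := ⊥
  have h1 : Continuous (fun w : Boundary α => w.1 n) :=
    (continuous_apply n).comp continuous_induced_dom
  exact (continuous_of_discreteTopology (f := f)).comp h1

theorem continuous_iff {X : Type*} [TopologicalSpace X] {f : X → Boundary α} :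
    Continuous f ↔ ∀ n, @Continuous _ _ _ ⊥ (fun x => (f x).1 n) := by
  let _ : TopologicalSpace (Letter α) := ⊥
  rw [continuous_induced_rng, continuous_pi_iff]
  rfl

theorem continuous_letterAct (l : Letter α) : Continuous (letterAct l) := by
  classical
  let _ : TopologicalSpace (Letter α) := ⊥
  have : DiscreteTopology (Letter α) := ⟨rfl⟩
  have hc : ∀ n, Continuous (fun w : Boundary α => w.1 n) := fun n =>
    continuous_coord_comp n id
  rw [continuous_iff]
  intro n
  have key : (fun w : Boundary α => (letterAct l w).1 n) = fun w =>
      if w.1 0 = Letter.inv l then w.1 (n + 1) else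
        (Nat.casesOn n l (fun m => w.1 m) : Letter α) := by
    funext w
    by_cases h : w.1 0 = Letter.inv l
    · rw [letterAct, dif_pos h, if_pos h]; rfl
    · rw [letterAct, dif_neg h, if_neg h]; rfl
  rw [key]
  have hcl : IsClopen {w : Boundary α | w.1 0 = Letter.inv l} :=
    (isClopen_discrete {Letter.inv l}).preimage (hc 0)
  refine Continuous.if ?_ (hc _) ?_
  · intro w hw
    rw [hcl.frontier_eq] at hw
    exact hw.elim
  · cases n with
    | zero => exact continuous_const
    | succ m => exact hc m

/-- Left multiplication by the generator `a`. -/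
noncomputable def generatorHomeo (a : α) : Boundary α ≃ₜ Boundary α where
  toFun := letterAct (a, true)
  invFun := letterAct (a, false)
  left_inv := letterAct_inv_letterAct (a, true)
  right_inv := letterAct_inv_letterAct (a, false)
  continuous_toFun := continuous_letterAct _
  continuous_invFun := continuous_letterAct _

/-- The action of the free group on its Gromov boundary by left multiplication. -/
noncomputable def actionHom (α : Type u) : FreeGroup α →* (Boundary α ≃ₜ Boundary α) :=
  FreeGroup.lift generatorHomeo

noncomputable instance : MulAction (FreeGroup α) (Boundary α) where
  smul g w := actionHom α g w
  one_smul w := by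
    change actionHom α 1 w = w
    rw [map_one]; rfl
  mul_smul g h w := by
    change actionHom α (g * h) w = actionHom α g (actionHom α h w)
    rw [map_mul]; rfl

instance : ContinuousConstSMul (FreeGroup α) (Boundary α) :=
  ⟨fun g => (actionHom α g).continuous⟩

instance [Finite α] : CompactSpace (Boundary α) := by
  let _ : TopologicalSpace (Letter α) := ⊥
  have : DiscreteTopology (Letter α) := ⟨rfl⟩
  have hcl : IsClosed {w : ℕ → Letter α | ∀ n, w (n + 1) ≠ Letter.inv (w n)} := by
    rw [Set.ofPred_forall]
    refine isClosed_iInter fun n => ?_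
    have : Continuous fun w : ℕ → Letter α => (w (n + 1), w n) := by fun_prop
    exact (isClosed_discrete {p : Letter α × Letter α | p.1 ≠ Letter.inv p.2}).preimage this
  exact isCompact_iff_compactSpace.mp hcl.isCompact

end Boundary

variable {α : Type u}

open Classical in
/-- Convergence of a sequence of group elements to a boundary point in the Gromov
compactification of the free group: each letter of the reduced words of `x n` is eventually the
corresponding letter of `ξ`. -/
def ConvergesTo (x : ℕ → FreeGroup α) (ξ : Boundary α) : Prop :=
  ∀ k : ℕ, ∀ᶠ n in atTop, (x n).toWord[k]? = some (ξ.1 k)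

/-- The boundary point `t^∞ = lim t^n` (it exists and is unique for every `t ≠ 1`; the value at
`t = 1` is irrelevant). -/
noncomputable def powLimit [Nonempty α] (t : FreeGroup α) : Boundary α :=
  Classical.epsilon fun ξ => ConvergesTo (fun n : ℕ => t ^ n) ξ

/-- An element is indivisible if it is not a proper power. -/
def Indivisible {G : Type*} [Group G] (g : G) : Prop :=
  ¬ ∃ (h : G) (n : ℕ), 2 ≤ n ∧ g = h ^ n

/-- The `Λ`-conjugacy class of `t`. -/
def conjClass {G : Type*} [Group G] (Λ : Subgroup G) (t : G) : Set G :=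
  {x | ∃ g ∈ Λ, x = g * t * g⁻¹}

/-- The relation `R_{T,Γ}`. -/
def IdentRel [Nonempty α] (T : Set (FreeGroup α)) (Γ : Subgroup (FreeGroup α))
    (x y : Boundary α) : Prop :=
  x = y ∨ ∃ g ∈ Γ, ∃ t ∈ T ∪ T⁻¹, x = g • powLimit t ∧ y = g • powLimit t⁻¹

/-- The quotient space of the boundary by `R_{T,Γ}`. -/
def QuotientSpace [Nonempty α] (T : Set (FreeGroup α)) (Γ : Subgroup (FreeGroup α)) : Type u :=
  Quot (IdentRel T Γ)

section quotient

variable [Nonempty α] {S T : Set (FreeGroup α)} {Γ : Subgroup (FreeGroup α)}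

instance : TopologicalSpace (QuotientSpace T Γ) :=
  inferInstanceAs (TopologicalSpace (Quot (IdentRel T Γ)))

/-- The quotient map. -/
def QuotientSpace.mk (T : Set (FreeGroup α)) (Γ : Subgroup (FreeGroup α)) :
    Boundary α → QuotientSpace T Γ :=
  Quot.mk (IdentRel T Γ)

theorem QuotientSpace.isQuotientMap_mk : IsQuotientMap (QuotientSpace.mk T Γ) :=
  isQuotientMap_quot_mk

theorem IdentRel.smul (g : Γ) {x y : Boundary α} (h : IdentRel T Γ x y) : IdentRel T Γ (g • x) (g • y) := by
  rcases h with rfl | ⟨k, hk, t, ht, rfl, rfl⟩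
  · exact Or.inl rfl
  · exact Or.inr ⟨g * k, Γ.mul_mem g.2 hk, t, ht,
      (mul_smul (g : FreeGroup α) k _).symm, (mul_smul (g : FreeGroup α) k _).symm⟩

theorem IdentRel.mono (hST : S ⊆ T) {x y : Boundary α} (h : IdentRel S Γ x y) : IdentRel T Γ x y := by
  rcases h with rfl | ⟨k, hk, t, ht, rfl, rfl⟩
  · exact Or.inl rfl
  · exact Or.inr ⟨k, hk, t, ht.imp (fun h => hST h) (fun h => hST h), rfl, rfl⟩

/-- The action of `Γ` on the quotient space that is induced by the action on the boundary. -/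
noncomputable instance : MulAction Γ (QuotientSpace T Γ) where
  smul g := Quot.map (fun x => g • x) fun _ _ h => h.smul g
  one_smul q := by
    induction q using Quot.ind with
    | mk x => exact congrArg (Quot.mk _) (one_smul Γ x)
  mul_smul g h q := by
    induction q using Quot.ind with
    | mk x => exact congrArg (Quot.mk _) (mul_smul g h x)

theorem QuotientSpace.smul_mk (g : Γ) (x : Boundary α) :
    g • QuotientSpace.mk T Γ x = QuotientSpace.mk T Γ (g • x) := rfl

instance : ContinuousConstSMul Γ (QuotientSpace T Γ) where
  continuous_const_smul g := by
    refine QuotientSpace.isQuotientMap_mk.continuous_iff.mpr ?_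
    exact QuotientSpace.isQuotientMap_mk.continuous.comp (continuous_const_smul (g : FreeGroup α))

instance [Finite α] : CompactSpace (QuotientSpace T Γ) :=
  inferInstanceAs (CompactSpace (Quot (IdentRel T Γ)))

end quotient

/-- A factor map (extension) of `Γ`-spaces: a `Γ`-equivariant topological quotient map. -/
structure IsFactorMap (Γ : Type*) [Group Γ] {Y X : Type*} [TopologicalSpace Y]
    [TopologicalSpace X] [MulAction Γ Y] [MulAction Γ X] (f : Y → X) : Prop where
  isQuotientMap : IsQuotientMap f
  map_smul : ∀ (g : Γ) (y : Y), f (g • y) = g • f y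

/-- An intermediate extension of the quotient map `π` from the boundary onto its quotient by
`R_{T,Γ}`: a locally compact Hausdorff `Γ`-space `Z` with factor maps `ρ` from the boundary to `Z`
and `ρ'` from `Z` to the quotient such that `ρ' ∘ ρ = π`. -/
structure IntermediateExtension [Nonempty α] (T : Set (FreeGroup α))
    (Γ : Subgroup (FreeGroup α)) where
  Z : Type u
  [topologicalSpace : TopologicalSpace Z]
  [t2Space : T2Space Z]
  [locallyCompactSpace : LocallyCompactSpace Z]
  [mulAction : MulAction Γ Z]
  [continuousConstSMul : ContinuousConstSMul Γ Z]
  ρ : Boundary α → Z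
  ρ' : Z → QuotientSpace T Γ
  isFactorMap_ρ : IsFactorMap Γ ρ
  isFactorMap_ρ' : IsFactorMap Γ ρ'
  comp_eq : ρ' ∘ ρ = QuotientSpace.mk T Γ

namespace IntermediateExtension

attribute [instance] topologicalSpace t2Space locallyCompactSpace mulAction continuousConstSMul

variable [Nonempty α] {T : Set (FreeGroup α)} {Γ : Subgroup (FreeGroup α)}

/-- Isomorphism of intermediate extensions: a `Γ`-equivariant homeomorphism that is compatible
with the factor maps. -/
def Iso (E F : IntermediateExtension T Γ) : Prop :=
  ∃ e : E.Z ≃ₜ F.Z, (∀ (g : Γ) (z : E.Z), e (g • z) = g • e z) ∧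
    e ∘ E.ρ = F.ρ ∧ F.ρ' ∘ e = E.ρ'

/-- Intermediate extensions are considered up to isomorphism. -/
instance setoid (T : Set (FreeGroup α)) (Γ : Subgroup (FreeGroup α)) :
    Setoid (IntermediateExtension T Γ) where
  r := Iso
  iseqv :=
    { refl := fun E => ⟨Homeomorph.refl _, fun _ _ => rfl, rfl, rfl⟩
      symm := by
        rintro E F ⟨e, h1, h2, h3⟩
        refine ⟨e.symm, fun g z => ?_, ?_, ?_⟩
        · rw [Homeomorph.symm_apply_eq, h1, Homeomorph.apply_symm_apply]
        · rw [← h2]; funext x; simp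
        · rw [← h3]; funext x; simp
      trans := by
        rintro E F G ⟨e, h1, h2, h3⟩ ⟨f, k1, k2, k3⟩
        refine ⟨e.trans f, fun g z => ?_, ?_, ?_⟩
        · simp [h1, k1]
        · rw [← k2, ← h2]; rfl
        · rw [← h3, ← k3]; rfl }

/-- The set `S_ρ` of all `t ∈ T` for which the fibre of `ρ` through `t^∞` has exactly two
points. -/
def doublePoints (E : IntermediateExtension T Γ) : Set (FreeGroup α) :=
  {t ∈ T | (E.ρ ⁻¹' {E.ρ (powLimit t)}).ncard = 2}

/-- For `S ⊆ T`, the quotient map `ρ_S` onto the quotient by `R_{S,Γ}` as an intermediate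
extension (once this quotient is known to be Hausdorff). -/
noncomputable def ofSubset [Finite α] (S : Set (FreeGroup α)) (hS : S ⊆ T)
    (hH : T2Space (QuotientSpace S Γ)) : IntermediateExtension T Γ where
  Z := QuotientSpace S Γ
  ρ := QuotientSpace.mk S Γ
  ρ' := Quot.map id fun _ _ h => h.mono hS
  isFactorMap_ρ := ⟨QuotientSpace.isQuotientMap_mk, fun _ _ => rfl⟩
  isFactorMap_ρ' := by
    have hc : Continuous (Quot.map id (fun _ _ h => h.mono hS) :
        QuotientSpace S Γ → QuotientSpace T Γ) :=
      QuotientSpace.isQuotientMap_mk.continuous_iff.mpr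
        (QuotientSpace.isQuotientMap_mk (T := T) (Γ := Γ)).continuous
    refine ⟨IsQuotientMap.of_comp QuotientSpace.isQuotientMap_mk.continuous hc
      (QuotientSpace.isQuotientMap_mk (T := T) (Γ := Γ)), fun g q => ?_⟩
    induction q using Quot.ind with
    | mk x => rfl
  comp_eq := rfl

end IntermediateExtension

end FreeGroupBoundary

open FreeGroupBoundary

/-! Two facts about indivisible u carry the proof. First, u^∞ determines u (`eq_of_powLimit_eq`):
point stabilizers are cyclic (`Boundary.isCyclic_stabilizer`), so indivisible elements fixing the
same point agree up to inversion, and u^∞ ≠ u^{-∞} fixes the sign. As g·t^∞ = (gtg⁻¹)^∞, the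
non-trivial classes of R_{S,Γ} are disjoint pairs {u^∞, u^{-∞}}. Second, write u = w c w⁻¹ with c
cyclically reduced. Both limits begin with w, and |c| is bounded on a conjugacy class, so for each N
only finitely many pairs split within the first N letters (`finite_identRel_not_agree`). A partition
into finite classes that shrink in this sense has Hausdorff quotient (`Boundary.t2Space_quot`).

For an intermediate extension, the kernel of ρ lies in R_{T,Γ}, so ρ only chooses which pairs to
glue. By equivariance the choice at t^∞ settles its whole Γ-orbit, and the kernel is R_{S_ρ,Γ}
(`ρ_eq_iff`). Quotient maps with equal kernels have isomorphic targets (`iso_of_ρ_eq_iff`).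
Conversely, condition 4 keeps the pairs of distinct elements of T in different orbits, so S can be
read off from R_{S,Γ} (`identRel_powLimit_iff`). -/

namespace FreeGroupBoundary

universe v

/-! ### Reduced words and convergence to boundary points -/

section words

open FreeGroup

variable {β : Type v}

open scoped Classical in
theorem toWord_letter_mul (l : Letter β) (x : FreeGroup β) :
    (FreeGroup.mk [l] * x).toWord =
      if x.toWord[0]? = some (Letter.inv l) then x.toWord.tail else l :: x.toWord := by
  have h1 : (FreeGroup.mk [l] * x).toWord = reduce (l :: x.toWord) := by
    conv_lhs => rw [← mk_toWord (x := x), mul_mk]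
    rfl
  rw [h1, reduce.cons, reduce_toWord]
  rcases hx : x.toWord with _ | ⟨a, w⟩
  · simp
  · obtain ⟨a1, a2⟩ := a
    obtain ⟨l1, l2⟩ := l
    by_cases h : l1 = a1 ∧ l2 = !a2
    · obtain ⟨rfl, rfl⟩ := h
      simp [Letter.inv]
    · have : ¬ ((a1, a2) = Letter.inv (l1, l2)) := by
        intro h'
        apply h
        simp only [Letter.inv, Prod.mk.injEq] at h'
        simp [h'.1, h'.2]
      simp [h, this]

theorem letter_smul (l : Letter β) (w : Boundary β) :
    FreeGroup.mk [l] • w = Boundary.letterAct l w := by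
  obtain ⟨a, b⟩ := l
  change Boundary.actionHom β (FreeGroup.mk [(a, b)]) w = _
  cases b
  · have : FreeGroup.mk [(a, false)] = (FreeGroup.of a)⁻¹ := rfl
    rw [this, _root_.map_inv, Boundary.actionHom, FreeGroup.lift_apply_of]
    rfl
  · have : FreeGroup.mk [(a, true)] = FreeGroup.of a := rfl
    rw [this, Boundary.actionHom, FreeGroup.lift_apply_of]
    rfl

theorem induction_letter_mul {p : FreeGroup β → Prop} (one : p 1)
    (mul : ∀ (l : Letter β) (g : FreeGroup β), p g → p (FreeGroup.mk [l] * g))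
    (g : FreeGroup β) : p g := by
  classical
  rw [← mk_toWord (x := g)]
  induction g.toWord with
  | nil => exact one
  | cons l L ih => simpa using mul l _ ih

/-- The first letter of `x n` is eventually that of `ξ`, so from then on both sides take the same
branch, cancelling or prepending. -/
theorem ConvergesTo.letter_mul {x : ℕ → FreeGroup β} {ξ : Boundary β} (h : ConvergesTo x ξ)
    (l : Letter β) : ConvergesTo (fun n => FreeGroup.mk [l] * x n) (Boundary.letterAct l ξ) := by
  intro k
  by_cases h0 : ξ.1 0 = Letter.inv l
  · filter_upwards [h 0, h (k + 1)] with n hn hk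
    rw [toWord_letter_mul, if_pos (by rw [hn, h0]), Boundary.letterAct, dif_pos h0]
    simpa [Boundary.tail] using hk
  · rw [Boundary.letterAct, dif_neg h0]
    rcases k with _ | k
    · filter_upwards [h 0] with n hn
      rw [toWord_letter_mul, if_neg (by rw [hn]; simpa using h0)]
      simp [Boundary.cons]
    · filter_upwards [h 0, h k] with n hn hk
      rw [toWord_letter_mul, if_neg (by rw [hn]; simpa using h0)]
      simpa [Boundary.cons] using hk

theorem ConvergesTo.mul_left {x : ℕ → FreeGroup β} {ξ : Boundary β} (h : ConvergesTo x ξ)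
    (g : FreeGroup β) : ConvergesTo (fun n => g * x n) (g • ξ) := by
  induction g using induction_letter_mul with
  | one => simpa using h
  | mul l g ih =>
    have := ih.letter_mul l
    rw [← letter_smul, smul_smul] at this
    simpa only [mul_assoc] using this

-- Right multiplication by a letter can destroy only the last letter, hence the bound on `k + 1`.
-- Inversion reduces this to left multiplication.
open scoped Classical in
theorem toWord_mul_letter_getElem? (x : FreeGroup β) (l : Letter β) {k : ℕ} {a : Letter β}
    (h : k + 1 < x.toWord.length) (hk : x.toWord[k]? = some a) :
    (x * FreeGroup.mk [l]).toWord[k]? = some a := by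
  have h1 : x * FreeGroup.mk [l] = (FreeGroup.mk [Letter.inv l] * x⁻¹)⁻¹ := by
    rw [mul_inv_rev, inv_inv, inv_mk]
    simp [invRev, Letter.inv]
  have h2 : invRev x⁻¹.toWord = x.toWord := by rw [toWord_inv, invRev_invRev]
  rw [h1, toWord_inv, toWord_letter_mul]
  split_ifs
  · have : invRev x⁻¹.toWord.tail = x.toWord.dropLast := by
      rw [← h2]
      simp [invRev]
    rw [this, List.getElem?_dropLast, if_pos (by omega), hk]
  · have : invRev (Letter.inv l :: x⁻¹.toWord) = x.toWord ++ [l] := by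
      rw [← h2]
      simp [invRev, Letter.inv]
    rw [this, List.getElem?_append_left (by omega), hk]

theorem ConvergesTo.mul_right {x : ℕ → FreeGroup β} {ξ : Boundary β} (h : ConvergesTo x ξ)
    (g : FreeGroup β) : ConvergesTo (fun n => x n * g) ξ := by
  induction g using induction_letter_mul generalizing x with
  | one => simpa using h
  | mul l g ih =>
    simp only [← mul_assoc]
    apply ih
    intro k
    -- Convergence at `k + 1` guarantees that the letter at `k` is not the last one.
    filter_upwards [h k, h (k + 1)] with n hk hk1
    obtain ⟨h2, -⟩ := List.getElem?_eq_some_iff.mp hk1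
    exact toWord_mul_letter_getElem? _ _ h2 hk

theorem ConvergesTo.unique {x : ℕ → FreeGroup β} {ξ η : Boundary β} (h : ConvergesTo x ξ)
    (h' : ConvergesTo x η) : ξ = η := by
  apply Boundary.ext
  intro k
  obtain ⟨n, h1, h2⟩ := ((h k).and (h' k)).exists
  rw [h1] at h2
  exact Option.some_injective _ h2

open scoped Classical in
theorem exists_convergesTo_of_prefix {x : ℕ → FreeGroup β}
    (hx : ∀ n, (x n).toWord <+: (x (n + 1)).toWord) (hl : ∀ n, n ≤ (x n).toWord.length) :
    ∃ ξ, ConvergesTo x ξ := by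
  have hmono : ∀ m n, m ≤ n → (x m).toWord <+: (x n).toWord := by
    intro m n hmn
    induction n, hmn using Nat.le_induction with
    | base => exact List.prefix_refl _
    | succ n _ ih => exact ih.trans (hx n)
  have hlt : ∀ k, k < (x (k + 1)).toWord.length := fun k => hl (k + 1)
  have key : ∀ k n, k + 1 ≤ n → (x n).toWord[k]? = some ((x (k + 1)).toWord[k]'(hlt k)) := by
    intro k n hkn
    obtain ⟨w, hw⟩ := hmono _ _ hkn
    rw [← hw, List.getElem?_append_left (hlt k), List.getElem?_eq_getElem]
  refine ⟨⟨fun k => (x (k + 1)).toWord[k]'(hlt k), fun k hk => ?_⟩, fun k => ?_⟩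
  -- Both letters are read in the one word of `x (k + 2)`, whose reducedness forbids cancellation.
  · have h1 := key k (k + 2) (by omega)
    have h2 := key (k + 1) (k + 2) (by omega)
    obtain ⟨h1l, h1⟩ := List.getElem?_eq_some_iff.mp h1
    obtain ⟨h2l, h2⟩ := List.getElem?_eq_some_iff.mp h2
    have hr : IsReduced (x (k + 2)).toWord := isReduced_toWord
    have := List.isChain_iff_getElem.mp hr k h2l
    rw [h1, h2] at this
    simp only [Letter.inv, Prod.ext_iff] at hk
    have := this hk.1.symm
    rw [hk.2] at this
    simp at this
  · filter_upwards [eventually_ge_atTop (k + 1)] with n hn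
    exact key k n hn

end words

/-! ### Limits of powers -/

section powers

open FreeGroup FreeGroup.reduceCyclically

variable {β : Type v}

open scoped Classical in
theorem reduceCyclically_toWord_ne_nil {u : FreeGroup β} (hu : u ≠ 1) :
    reduceCyclically u.toWord ≠ [] := by
  intro h
  apply hu
  have := conj_conjugator_reduceCyclically u.toWord
  rw [h, List.append_nil] at this
  rw [← mk_toWord (x := u), ← this, ← mul_mk, ← inv_mk, mul_inv_cancel]

-- In u^n = w c^n w⁻¹, with c cyclically reduced, nothing cancels; for n = 0 the factors w and w⁻¹
-- would.
open scoped Classical in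
theorem toWord_pow_eq (u : FreeGroup β) {n : ℕ} (hn : n ≠ 0) :
    (u ^ n).toWord = conjugator u.toWord ++ ((List.replicate n (reduceCyclically u.toWord)).flatten
      ++ invRev (conjugator u.toWord)) := by
  rw [toWord_pow, reduce_flatten_replicate isReduced_toWord, if_neg hn, List.append_assoc]

open scoped Classical in
theorem toWord_inv_pow_eq (u : FreeGroup β) {n : ℕ} (hn : n ≠ 0) :
    (u⁻¹ ^ n).toWord = conjugator u.toWord ++
      (invRev (List.replicate n (reduceCyclically u.toWord)).flatten
      ++ invRev (conjugator u.toWord)) := by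
  rw [inv_pow, toWord_inv, toWord_pow_eq u hn]
  simp [invRev, Function.comp_def]

/-- Powers of the cyclically reduced core are nested prefixes; conjugation then moves the limit by
`w`. -/
theorem exists_convergesTo_pow {u : FreeGroup β} (hu : u ≠ 1) :
    ∃ ξ, ConvergesTo (fun n : ℕ => u ^ n) ξ := by
  classical
  set L := reduceCyclically u.toWord with hL
  set c := FreeGroup.mk L with hc
  have hred : IsCyclicallyReduced L := reduceCyclically.isCyclicallyReduced isReduced_toWord
  have hword : ∀ n, (c ^ n).toWord = (List.replicate n L).flatten := by
    intro n
    rw [toWord_pow, hc, toWord_mk, hred.isReduced.reduce_eq]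
    exact (hred.flatten_replicate n).isReduced.reduce_eq
  have hlen : 1 ≤ L.length :=
    List.length_pos_iff.mpr (reduceCyclically_toWord_ne_nil hu)
  obtain ⟨ξ, hξ⟩ : ∃ ξ, ConvergesTo (fun n : ℕ => c ^ n) ξ := by
    apply exists_convergesTo_of_prefix
    · intro n
      rw [hword, hword, List.replicate_succ', List.flatten_concat]
      exact List.prefix_append _ _
    · intro n
      rw [hword]
      simpa using Nat.le_mul_of_pos_right n hlen
  have hu' : u = FreeGroup.mk (conjugator u.toWord) * c * (FreeGroup.mk (conjugator u.toWord))⁻¹ := by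
    rw [hc, inv_mk, mul_mk, mul_mk, conj_conjugator_reduceCyclically, mk_toWord]
  set w := FreeGroup.mk (conjugator u.toWord)
  refine ⟨w • ξ, ?_⟩
  have := (hξ.mul_left w).mul_right w⁻¹
  simpa only [hu', conj_pow] using this

-- The core length is the translation length: n|c| ≤ |u^n| ≤ n|t| + 2|g|, and the term 2|g| is
-- negligible for large n.
open scoped Classical in
theorem length_reduceCyclically_le (t g : FreeGroup β) :
    (reduceCyclically (g * t * g⁻¹).toWord).length ≤ t.norm := by
  set u := g * t * g⁻¹ with hu
  -- Just large enough that |c| ≥ |t| + 1 would give n ≤ 2|g|.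
  set n := 2 * g.norm + 1 with hn
  have hpow : ∀ m, (t ^ m).norm ≤ m * t.norm := by
    intro m
    induction m with
    | zero => simp
    | succ m ih =>
      rw [pow_succ, add_one_mul]
      exact (FreeGroup.norm_mul_le _ _).trans (by omega)
  have h1 : (u ^ n).norm ≤ n * t.norm + 2 * g.norm := by
    rw [hu, conj_pow]
    have h2 := FreeGroup.norm_mul_le (g * t ^ n) g⁻¹
    have h3 := FreeGroup.norm_mul_le g (t ^ n)
    have h4 := hpow n
    rw [norm_inv_eq] at h2
    omega
  have h5 : n * (reduceCyclically u.toWord).length ≤ (u ^ n).norm := by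
    rw [FreeGroup.norm, toWord_pow_eq u (by omega)]
    simp
    omega
  by_contra! h
  have h6 : n * (t.norm + 1) ≤ n * (reduceCyclically u.toWord).length := Nat.mul_le_mul_left n h
  rw [mul_add_one] at h6
  omega

theorem finite_norm_le [Finite β] (M : ℕ) :
    {u : FreeGroup β | open scoped Classical in u.norm ≤ M}.Finite := by
  classical
  exact (List.finite_length_le (Letter β) M).preimage toWord_injective.injOn

variable [Nonempty β]

theorem convergesTo_powLimit {u : FreeGroup β} (hu : u ≠ 1) :
    ConvergesTo (fun n : ℕ => u ^ n) (powLimit u) :=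
  Classical.epsilon_spec (exists_convergesTo_pow hu)

theorem smul_powLimit {u : FreeGroup β} (hu : u ≠ 1) (g : FreeGroup β) :
    g • powLimit u = powLimit (g * u * g⁻¹) := by
  have h1 := ((convergesTo_powLimit hu).mul_left g).mul_right g⁻¹
  have h2 : ConvergesTo (fun n : ℕ => (g * u * g⁻¹) ^ n) (powLimit (g * u * g⁻¹)) :=
    convergesTo_powLimit (by simpa using hu)
  simp only [conj_pow] at h2
  exact h1.unique h2

open scoped Classical in
theorem powLimit_prefix {u : FreeGroup β} (hu : u ≠ 1) {k : ℕ}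
    (hk : k < (conjugator u.toWord).length) :
    (powLimit u).1 k = (powLimit u⁻¹).1 k := by
  obtain ⟨n, ⟨h1, h2⟩, hn⟩ := ((((convergesTo_powLimit hu) k).and
    ((convergesTo_powLimit (inv_ne_one.mpr hu)) k)).and (eventually_ne_atTop 0)).exists
  rw [toWord_pow_eq u hn, List.getElem?_append_left hk] at h1
  rw [toWord_inv_pow_eq u hn, List.getElem?_append_left hk, h1] at h2
  exact Option.some_injective _ h2

/-- After the common prefix w, one limit continues with the first letter of c^n, the other with the
inverse of its last letter. Equality would contradict cyclic reducedness. -/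
theorem powLimit_ne_powLimit_inv {u : FreeGroup β} (hu : u ≠ 1) :
    powLimit u ≠ powLimit u⁻¹ := by
  classical
  intro heq
  set W := conjugator u.toWord with hW
  obtain ⟨n, ⟨h1, h2⟩, hn⟩ := ((((convergesTo_powLimit hu) W.length).and
    ((convergesTo_powLimit (inv_ne_one.mpr hu)) W.length)).and (eventually_ne_atTop 0)).exists
  set L := reduceCyclically u.toWord with hL
  have hLn : L ≠ [] := reduceCyclically_toWord_ne_nil hu
  have hred : IsCyclicallyReduced L := reduceCyclically.isCyclicallyReduced isReduced_toWord
  set F := (List.replicate n L).flatten with hF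
  have hF0 : 0 < F.length := by
    simp [F, Nat.pos_of_ne_zero hn, List.length_pos_iff.mpr hLn]
  have hFred : IsCyclicallyReduced F := hred.flatten_replicate n
  rw [toWord_pow_eq u hn, ← hW, ← hL, ← hF, List.getElem?_append_right le_rfl, Nat.sub_self,
    List.getElem?_append_left hF0, ← List.head?_eq_getElem?] at h1
  rw [toWord_inv_pow_eq u hn, ← hW, ← hL, ← hF, List.getElem?_append_right le_rfl, Nat.sub_self,
    List.getElem?_append_left (by simpa using hF0), ← List.head?_eq_getElem?, ← heq] at h2
  have h3 : F.getLast? = some (Letter.inv ((powLimit u).1 W.length)) := by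
    simp only [invRev, List.head?_reverse, List.getLast?_map, Option.map_eq_some_iff] at h2
    obtain ⟨a, ha, hb⟩ := h2
    rw [ha, ← hb]
    simp [Letter.inv]
  have := hFred.2 _ h3 _ h1
  simp [Letter.inv] at this

end powers

/-! ### Stabilizers of boundary points and indivisible elements -/

section stabilizer

variable {β : Type v}

namespace Boundary

/-- The group element represented by the first `n` letters of an infinite reduced word. -/
def prefixElt (ξ : Boundary β) (n : ℕ) : FreeGroup β := FreeGroup.mk ((List.range n).map ξ.1)

theorem norm_prefixElt [DecidableEq β] (ξ : Boundary β) (n : ℕ) : (prefixElt ξ n).norm = n := by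
  have hred : FreeGroup.IsReduced ((List.range n).map ξ.1) := by
    refine List.isChain_iff_getElem.mpr fun i hi h => ?_
    simp only [List.getElem_map, List.getElem_range] at h ⊢
    by_contra h2
    apply ξ.2 i
    refine Prod.ext h.symm ?_
    simp only [Letter.inv]
    cases h3 : (ξ.1 i).2 <;> cases h4 : (ξ.1 (i + 1)).2 <;> simp_all
  rw [FreeGroup.norm, prefixElt, FreeGroup.toWord_mk, hred.reduce_eq]
  simp

theorem prefixElt_injective (ξ : Boundary β) : Function.Injective (prefixElt ξ) := by
  classical
  intro m n h
  rw [← norm_prefixElt ξ m, h, norm_prefixElt]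

theorem prefixElt_add_one (ξ : Boundary β) (n : ℕ) :
    prefixElt ξ (n + 1) = FreeGroup.mk [ξ.1 0] * prefixElt (tail ξ) n := by
  rw [prefixElt, prefixElt, FreeGroup.mul_mk, List.range_succ_eq_map]
  simp [tail, Function.comp_def]

/-- A letter changes only the front of a word, so far enough out `g` shifts the length of prefixes
by the constant `M - N`. -/
theorem exists_mul_prefixElt (g : FreeGroup β) (ξ : Boundary β) :
    ∃ N M, ∀ k, g * prefixElt ξ (N + k) = prefixElt (g • ξ) (M + k) := by
  induction g using induction_letter_mul with
  | one => exact ⟨0, 0, fun k => by simp⟩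
  | mul l g ih =>
    obtain ⟨N, M, h⟩ := ih
    obtain ⟨N', M', h'⟩ : ∃ N' M', ∀ k, FreeGroup.mk [l] * prefixElt (g • ξ) (N' + k) =
        prefixElt (FreeGroup.mk [l] • g • ξ) (M' + k) := by
      rw [letter_smul]
      generalize g • ξ = η
      by_cases h0 : η.1 0 = Letter.inv l
      · refine ⟨1, 0, fun k => ?_⟩
        rw [letterAct, dif_pos h0, add_comm 1 k, prefixElt_add_one, h0, ← mul_assoc]
        have : FreeGroup.mk [Letter.inv l] = (FreeGroup.mk [l])⁻¹ := rfl
        rw [this, mul_inv_cancel, one_mul, zero_add]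
      · refine ⟨0, 1, fun k => ?_⟩
        rw [letterAct, dif_neg h0, add_comm 1 k, prefixElt_add_one, zero_add]
        rfl
    refine ⟨N + N', M' + M, fun k => ?_⟩
    rw [mul_assoc, add_assoc, h, mul_smul, add_assoc, ← h']
    congr 2
    omega

/-- The stabilizer of a boundary point is cyclic: the shift of the tails embeds it into `ℤ`. -/
theorem isCyclic_stabilizer (ξ : Boundary β) :
    IsCyclic (MulAction.stabilizer (FreeGroup β) ξ) := by
  have h : ∀ g : MulAction.stabilizer (FreeGroup β) ξ, ∃ p : ℕ × ℕ, ∀ k,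
      (g : FreeGroup β) * prefixElt ξ (p.1 + k) = prefixElt ξ (p.2 + k) := by
    intro g
    obtain ⟨N, M, h⟩ := exists_mul_prefixElt (g : FreeGroup β) ξ
    rw [MulAction.mem_stabilizer_iff.mp g.2] at h
    exact ⟨(N, M), h⟩
  choose p hp using h
  let f : MulAction.stabilizer (FreeGroup β) ξ →* Multiplicative ℤ :=
    MonoidHom.mk' (fun g => Multiplicative.ofAdd ((p g).2 - (p g).1 : ℤ)) (by
      intro g h
      rw [← ofAdd_add]
      congr 1
      -- The three values of `k` are padded so that the relations for `h` and `g` compose to the one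
      -- for `g * h`; comparing prefix lengths gives additivity.
      have h1 := hp (g * h) ((p h).1 + (p g).1)
      have h2 := hp h ((p (g * h)).1 + (p g).1)
      have h3 := hp g ((p (g * h)).1 + (p h).2)
      rw [Subgroup.coe_mul, mul_assoc,
        show (p (g * h)).1 + ((p h).1 + (p g).1) = (p h).1 + ((p (g * h)).1 + (p g).1) by omega,
        h2, show (p h).2 + ((p (g * h)).1 + (p g).1) = (p g).1 + ((p (g * h)).1 + (p h).2) by omega,
        h3] at h1
      have := prefixElt_injective ξ h1
      omega)
  refine isCyclic_of_injective f ((injective_iff_map_eq_one f).mpr fun g hg => ?_)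
  have h1 : ((p g).2 - (p g).1 : ℤ) = 0 := hg
  -- With shift zero, `g` times a prefix is that same prefix, so `g = 1`.
  have h2 := hp g 0
  rw [show (p g).2 = (p g).1 by omega] at h2
  exact Subtype.ext (mul_eq_right.mp h2)

end Boundary

theorem Indivisible.ne_one {G : Type*} [Group G] {g : G} (h : Indivisible g) : g ≠ 1 :=
  fun h1 => h ⟨1, 2, le_rfl, by rw [h1, one_pow]⟩

theorem Indivisible.inv {G : Type*} [Group G] {g : G} (h : Indivisible g) : Indivisible g⁻¹ := by
  rintro ⟨k, n, hn, hk⟩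
  exact h ⟨k⁻¹, n, hn, by rw [inv_pow, ← hk, inv_inv]⟩

theorem Indivisible.conj {G : Type*} [Group G] {g : G} (h : Indivisible g) (a : G) :
    Indivisible (a * g * a⁻¹) := by
  rintro ⟨k, n, hn, hk⟩
  refine h ⟨a⁻¹ * k * a, n, hn, ?_⟩
  have := conj_pow (a := a⁻¹) (b := k) (i := n)
  rw [inv_inv] at this
  rw [this, ← hk]
  group

theorem Indivisible.eq_or_eq_inv {G : Type*} [Group G] {g h : G} (hg : Indivisible g)
    (hgh : g ∈ Subgroup.zpowers h) : g = h ∨ g = h⁻¹ := by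
  obtain ⟨n, rfl⟩ := hgh
  obtain ⟨m, rfl | rfl⟩ := n.eq_nat_or_neg
  · have h0 : m ≠ 0 := fun h0 => hg.ne_one (by simp [h0])
    have h2 : ¬ 2 ≤ m := fun h2 => hg ⟨h, m, h2, by simp⟩
    obtain rfl : m = 1 := by omega
    simp
  · have h0 : m ≠ 0 := fun h0 => hg.ne_one (by simp [h0])
    have h2 : ¬ 2 ≤ m := fun h2 => hg ⟨h⁻¹, m, h2, by simp⟩
    obtain rfl : m = 1 := by omega
    simp

theorem indivisible_of_mem_union_inv {G : Type*} [Group G] {S : Set G}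
    (hS : ∀ t ∈ S, Indivisible t) : ∀ t ∈ S ∪ S⁻¹, Indivisible t := by
  rintro t (ht | ht)
  · exact hS t ht
  · simpa using (hS _ ht).inv

/-- Both elements lie in the cyclic stabilizer of the common limit, so each is its generator or the
inverse; opposite signs would give v^∞ = v^{-∞}. -/
theorem eq_of_powLimit_eq [Nonempty β] {u v : FreeGroup β} (hu : Indivisible u)
    (hv : Indivisible v) (h : powLimit u = powLimit v) : u = v := by
  have hmem : ∀ w : FreeGroup β, Indivisible w → w ∈ MulAction.stabilizer (FreeGroup β) (powLimit w) := by
    intro w hw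
    rw [MulAction.mem_stabilizer_iff, smul_powLimit hw.ne_one, mul_inv_cancel_right]
  have hvs : v ∈ MulAction.stabilizer (FreeGroup β) (powLimit u) := h ▸ hmem v hv
  have := Boundary.isCyclic_stabilizer (powLimit u)
  obtain ⟨⟨c, hc⟩, hgen⟩ := IsCyclic.exists_generator (α := MulAction.stabilizer (FreeGroup β) (powLimit u))
  have hz : ∀ w ∈ MulAction.stabilizer (FreeGroup β) (powLimit u), w ∈ Subgroup.zpowers c := by
    intro w hw
    obtain ⟨n, hn⟩ := hgen ⟨w, hw⟩
    exact ⟨n, congrArg Subtype.val hn⟩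
  have hne : u ≠ v⁻¹ := by
    rintro rfl
    exact powLimit_ne_powLimit_inv hv.ne_one h.symm
  rcases hu.eq_or_eq_inv (hz u (hmem u hu)) with h1 | h1 <;>
    rcases hv.eq_or_eq_inv (hz v hvs) with h2 | h2
  · rw [h1, h2]
  · rw [h1, h2, inv_inv] at hne
    exact absurd rfl hne
  · rw [h1, h2] at hne
    exact absurd rfl hne
  · rw [h1, h2]

end stabilizer

/-! ### Hausdorff quotients of the boundary -/

section topology

variable {β : Type v}

instance : T2Space (Boundary β) := by
  let _ : TopologicalSpace (Letter β) := ⊥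
  have : DiscreteTopology (Letter β) := ⟨rfl⟩
  exact T2Space.of_injective_continuous Subtype.val_injective continuous_induced_dom

namespace Boundary

/-- The first `N` letters of two infinite words agree. -/
def Agree (N : ℕ) (x y : Boundary β) : Prop := ∀ k < N, x.1 k = y.1 k

theorem Agree.symm {N : ℕ} {x y : Boundary β} (h : Agree N x y) : Agree N y x :=
  fun k hk => (h k hk).symm

theorem Agree.trans {N : ℕ} {x y z : Boundary β} (h : Agree N x y) (h' : Agree N y z) :
    Agree N x z :=
  fun k hk => (h k hk).trans (h' k hk)

theorem isOpen_agree (N : ℕ) (y : Boundary β) : IsOpen {x | Agree N x y} := by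
  let _ : TopologicalSpace (Letter β) := ⊥
  have : DiscreteTopology (Letter β) := ⟨rfl⟩
  have h : {x | Agree N x y} = ⋂ k ∈ Set.Iio N, (fun x : Boundary β => x.1 k) ⁻¹' {y.1 k} := by
    ext x
    simp [Agree]
  rw [h]
  exact (Set.finite_Iio N).isOpen_biInter fun k _ =>
    (isOpen_discrete _).preimage (continuous_coord_comp k id)

theorem eventually_not_agree {x y : Boundary β} (h : x ≠ y) : ∀ᶠ N in atTop, ¬ Agree N x y := by
  obtain ⟨k, hk⟩ : ∃ k, x.1 k ≠ y.1 k := by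
    by_contra! h'
    exact h (ext h')
  filter_upwards [eventually_gt_atTop k] with N hN h'
  exact hk (h' k hN)

/-- The union of the class of `x` with the classes that lie inside a cylinder that meets the class
of `x`. -/
theorem isOpen_saturation {R : Boundary β → Boundary β → Prop} {N : ℕ}
    (hN : {p | ∃ q, R p q ∧ ¬ Agree N p q}.Finite) (x : Boundary β) :
    IsOpen {p | R p x ∨ ((∀ q, R p q → Agree N p q) ∧ ∃ a, R a x ∧ Agree N p a)} := by
  rw [isOpen_iff_mem_nhds]
  rintro p hp
  have hex : ∃ a, R a x ∧ Agree N p a := by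
    rcases hp with hp | hp
    · exact ⟨p, hp, fun _ _ => rfl⟩
    · exact hp.2
  obtain ⟨a, ha, hpa⟩ := hex
  have h1 : {q | Agree N q a} ∈ 𝓝 p := (isOpen_agree N a).mem_nhds hpa
  -- The finitely many points with a large class, other than `p`, form a closed set, so near `p` all
  -- other classes are small.
  have h2 : ({p | ∃ q, R p q ∧ ¬ Agree N p q} \ {p})ᶜ ∈ 𝓝 p :=
    (hN.subset Set.sdiff_subset).isClosed.isOpen_compl.mem_nhds (by simp)
  filter_upwards [h1, h2] with q hq1 hq2
  by_cases hqp : q = p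
  · rwa [hqp]
  · refine Or.inr ⟨fun r hr => ?_, a, ha, hq1⟩
    by_contra h
    exact hq2 ⟨⟨r, hr, h⟩, hqp⟩

/-- Choose `N` so that no point of one class agrees with a point of the other up to `N`. The
saturated open sets of `isOpen_saturation` are then disjoint: a common point would chain two such
points together. -/
theorem t2Space_quot {R : Boundary β → Boundary β → Prop} (hR : Equivalence R)
    (hfin : ∀ x, {a | R a x}.Finite)
    (hN : ∀ N, {p | ∃ q, R p q ∧ ¬ Agree N p q}.Finite) : T2Space (Quot R) := by
  have hquot : IsQuotientMap (Quot.mk R) := isQuotientMap_quot_mk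
  have hmk : ∀ {a b}, Quot.mk R a = Quot.mk R b ↔ R a b := fun {a b} => by
    rw [Quot.eq, hR.eqvGen_iff]
  refine ⟨fun x y => ?_⟩
  induction x using Quot.ind with | mk x => ?_
  induction y using Quot.ind with | mk y => ?_
  intro hxy
  have hxy : ¬ R x y := fun h => hxy (hmk.mpr h)
  obtain ⟨N, hNxy⟩ : ∃ N, ∀ a ∈ {a | R a x}, ∀ b ∈ {b | R b y}, ¬ Agree N a b := by
    refine Eventually.exists (f := atTop) ?_
    rw [(hfin x).eventually_all]
    intro a ha
    rw [(hfin y).eventually_all]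
    intro b hb
    refine eventually_not_agree ?_
    rintro rfl
    exact hxy (hR.trans (hR.symm ha) hb)
  -- The class of `x` is included separately because it need not lie in one cylinder.
  let U : Boundary β → Set (Boundary β) := fun x =>
    {p | R p x ∨ ((∀ q, R p q → Agree N p q) ∧ ∃ a, R a x ∧ Agree N p a)}
  have hsat : ∀ x p q, R p q → p ∈ U x → q ∈ U x := by
    rintro x p q hpq (hp | ⟨hp, a, ha, hpa⟩)
    · exact Or.inl (hR.trans (hR.symm hpq) hp)
    · have hqp := (hp q hpq).symm
      exact Or.inr ⟨fun r hr => hqp.trans (hp r (hR.trans hpq hr)), a, ha, hqp.trans hpa⟩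
  have hpre : ∀ x, Quot.mk R ⁻¹' (Quot.mk R '' U x) = U x := by
    intro x
    refine Set.Subset.antisymm ?_ (Set.subset_preimage_image _ _)
    rintro q ⟨p, hp, hpq⟩
    exact hsat x p q (hmk.mp hpq) hp
  have hopen : ∀ x, IsOpen (Quot.mk R '' U x) := by
    intro x
    rw [← hquot.isOpen_preimage, hpre]
    exact isOpen_saturation (hN N) x
  refine ⟨_, _, hopen x, hopen y, ⟨x, Or.inl (hR.refl x), rfl⟩, ⟨y, Or.inl (hR.refl y), rfl⟩, ?_⟩
  rw [Set.disjoint_left]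
  rintro _ ⟨p, hp, rfl⟩ hp'
  have hp' : p ∈ U y := by
    rw [← hpre y]
    exact hp'
  rcases hp with hp | ⟨hp, a, ha, hpa⟩
  · rcases hp' with hq | ⟨-, b, hb, hpb⟩
    · exact hxy (hR.trans (hR.symm hp) hq)
    · exact hNxy p hp b hb hpb
  · rcases hp' with hq | ⟨-, b, hb, hpb⟩
    · exact hNxy a ha p hq hpa.symm
    · exact hNxy a ha b hb (hpa.symm.trans hpb)

end Boundary

/-! ### The classes of R_{S,Γ} -/

open Boundary

variable [Nonempty β]

theorem finite_conjClass_not_agree [Finite β] {t : FreeGroup β} (ht : t ≠ 1) (N : ℕ) :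
    {u ∈ conjClass ⊤ t | ¬ Agree N (powLimit u) (powLimit u⁻¹)}.Finite := by
  classical
  -- Here |u| = |c| + 2|w|, where |c| ≤ |t|, and |w| ≤ N because the limits share the prefix w.
  refine (finite_norm_le (2 * N + t.norm)).subset ?_
  rintro u ⟨⟨g, -, rfl⟩, hu⟩
  have h1 := length_reduceCyclically_le t g
  have h2 : (FreeGroup.reduceCyclically.conjugator (g * t * g⁻¹).toWord).length ≤ N := by
    by_contra! h
    exact hu fun k hk => powLimit_prefix (by simpa using ht) (hk.trans h)
  have h3 := congrArg List.length
    (FreeGroup.reduceCyclically.conj_conjugator_reduceCyclically (g * t * g⁻¹).toWord)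
  simp only [List.length_append, FreeGroup.invRev_length] at h3
  change FreeGroup.norm _ ≤ _
  rw [FreeGroup.norm]
  omega

variable {S T : Set (FreeGroup β)} {Γ : Subgroup (FreeGroup β)}

/-- Conjugates replace translates, so that `eq_of_powLimit_eq` applies. -/
theorem identRel_iff (hS : ∀ t ∈ S, Indivisible t) {x y : Boundary β} :
    IdentRel S Γ x y ↔ x = y ∨ ∃ g ∈ Γ, ∃ t ∈ S ∪ S⁻¹,
      x = powLimit (g * t * g⁻¹) ∧ y = powLimit (g * t * g⁻¹)⁻¹ := by
  refine or_congr_right ?_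
  have key : ∀ g : FreeGroup β, ∀ t ∈ S ∪ S⁻¹, g • powLimit t = powLimit (g * t * g⁻¹) ∧
      g • powLimit t⁻¹ = powLimit (g * t * g⁻¹)⁻¹ := by
    intro g t ht
    have ht1 : t ≠ 1 := by
      rcases ht with ht | ht
      · exact (hS t ht).ne_one
      · exact inv_ne_one.mp (hS _ ht).ne_one
    rw [smul_powLimit ht1, smul_powLimit (inv_ne_one.mpr ht1), conj_inv]
    exact ⟨rfl, rfl⟩
  constructor
  · rintro ⟨g, hg, t, ht, rfl, rfl⟩
    exact ⟨g, hg, t, ht, (key g t ht).1, (key g t ht).2⟩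
  · rintro ⟨g, hg, t, ht, rfl, rfl⟩
    exact ⟨g, hg, t, ht, (key g t ht).1.symm, (key g t ht).2.symm⟩

theorem identRel_equivalence (hS : ∀ t ∈ S, Indivisible t) : Equivalence (IdentRel S Γ) where
  refl _ := Or.inl rfl
  symm := by
    rintro x y (rfl | ⟨g, hg, t, ht, rfl, rfl⟩)
    · exact Or.inl rfl
    · exact Or.inr ⟨g, hg, t⁻¹, by simpa using ht.symm, rfl, by rw [inv_inv]⟩
  trans := by
    intro x y z hxy hyz
    have hS' := indivisible_of_mem_union_inv hS
    rcases (identRel_iff hS).mp hxy with rfl | ⟨g, hg, t, ht, hx, hy⟩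
    · exact hyz
    rcases (identRel_iff hS).mp hyz with rfl | ⟨h, hh, s, hs, hy', hz⟩
    · exact hxy
    -- With u = gtg⁻¹ and v = hsh⁻¹, the middle point is u^{-∞} = v^∞, so v = u⁻¹ and the chain
    -- returns to x.
    left
    have := eq_of_powLimit_eq ((hS' t ht).conj g).inv ((hS' s hs).conj h) (hy.symm.trans hy')
    rw [hx, hz, ← this, inv_inv]

theorem identRel_finite (hS : ∀ t ∈ S, Indivisible t) (x : Boundary β) :
    {a | IdentRel S Γ a x}.Finite := by
  by_cases h : ∃ g ∈ Γ, ∃ t ∈ S ∪ S⁻¹, x = powLimit (g * t * g⁻¹)⁻¹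
  · obtain ⟨g, hg, t, ht, hx⟩ := h
    refine (Set.toFinite {x, powLimit (g * t * g⁻¹)}).subset fun a ha => ?_
    have hS' := indivisible_of_mem_union_inv hS
    rcases (identRel_iff hS).mp ha with rfl | ⟨h, hh, s, hs, hy, hz⟩
    · exact Or.inl rfl
    · right
      have := eq_of_powLimit_eq ((hS' t ht).conj g).inv ((hS' s hs).conj h).inv (hx.symm.trans hz)
      rw [inv_inj] at this
      rw [hy, this]
      rfl
  · refine (Set.finite_singleton x).subset fun a ha => ?_
    rcases (identRel_iff hS).mp ha with rfl | ⟨g, hg, t, ht, -, hx⟩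
    · rfl
    · exact absurd ⟨g, hg, t, ht, hx⟩ h

theorem finite_identRel_not_agree [Finite β] (hS : ∀ t ∈ S, Indivisible t)
    (hfin : {C : Set (FreeGroup β) | ∃ t ∈ S, C = conjClass ⊤ t}.Finite) (N : ℕ) :
    {p | ∃ q, IdentRel S Γ p q ∧ ¬ Agree N p q}.Finite := by
  let F : Set (FreeGroup β) := ⋃ C ∈ {C : Set (FreeGroup β) | ∃ t ∈ S, C = conjClass ⊤ t},
    {u ∈ C | ¬ Agree N (powLimit u) (powLimit u⁻¹)}
  have hF : F.Finite := by
    refine hfin.biUnion ?_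
    rintro C ⟨t, ht, rfl⟩
    exact finite_conjClass_not_agree (hS t ht).ne_one N
  have hmem : ∀ g : FreeGroup β, ∀ t ∈ S,
      ¬ Agree N (powLimit (g * t * g⁻¹)) (powLimit (g * t * g⁻¹)⁻¹) → g * t * g⁻¹ ∈ F := by
    intro g t ht h
    exact Set.mem_biUnion (x := conjClass ⊤ t) ⟨t, ht, rfl⟩ ⟨⟨g, trivial, rfl⟩, h⟩
  refine ((hF.image powLimit).union (hF.image fun u => powLimit u⁻¹)).subset ?_
  rintro p ⟨q, hpq, hN⟩
  rcases (identRel_iff hS).mp hpq with rfl | ⟨g, -, t, ht | ht, rfl, rfl⟩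
  · exact absurd (fun _ _ => rfl) hN
  · exact Or.inl ⟨_, hmem g t ht hN, rfl⟩
  · refine Or.inr ⟨_, hmem g t⁻¹ ht fun h => hN ?_, ?_⟩
    · rw [← conj_inv, inv_inv] at h
      exact h.symm
    · simp only [conj_inv, inv_inv]

theorem t2Space_quotientSpace [Finite β] (hS : ∀ t ∈ S, Indivisible t)
    (hfin : {C : Set (FreeGroup β) | ∃ t ∈ S, C = conjClass ⊤ t}.Finite) :
    T2Space (QuotientSpace S Γ) :=
  t2Space_quot (identRel_equivalence hS) (identRel_finite hS) (finite_identRel_not_agree hS hfin)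

theorem QuotientSpace.mk_eq_mk_iff (hS : ∀ t ∈ S, Indivisible t) {x y : Boundary β} :
    QuotientSpace.mk S Γ x = QuotientSpace.mk S Γ y ↔ IdentRel S Γ x y :=
  Quot.eq.trans (by rw [(identRel_equivalence hS).eqvGen_iff])

/-- If t^∞ = (gsg⁻¹)^∞ then t = gsg⁻¹, and `hTconj` leaves only s = t or s⁻¹ = t. The second case,
s⁻¹ ∈ S, is where excluding `t⁻¹` from the class is needed. -/
theorem identRel_powLimit_iff (hT : ∀ t ∈ T, Indivisible t)
    (hTconj : ∀ s ∈ T, ∀ t ∈ T, s ≠ t → conjClass Γ s ∩ {t, t⁻¹} = ∅) (hST : S ⊆ T)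
    {t : FreeGroup β} (ht : t ∈ T) {y : Boundary β} :
    IdentRel S Γ (powLimit t) y ↔ y = powLimit t ∨ (t ∈ S ∧ y = powLimit t⁻¹) := by
  constructor
  · intro h
    rcases (identRel_iff fun s hs => hT s (hST hs)).mp h with rfl | ⟨g, hg, s, hs, h1, h2⟩
    · exact Or.inl rfl
    · right
      have hs' := indivisible_of_mem_union_inv (fun s hs => hT s (hST hs)) s hs
      have hts := eq_of_powLimit_eq (hT t ht) (hs'.conj g) h1
      rw [← hts] at h2
      refine ⟨?_, h2⟩
      rcases hs with hs | hs
      · by_contra h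
        have := hTconj s (hST hs) t ht (by rintro rfl; exact h hs)
        exact Set.notMem_empty t (this ▸ ⟨⟨g, hg, hts⟩, Or.inl rfl⟩)
      · by_contra h
        have := hTconj s⁻¹ (hST hs) t ht (fun h' => h (h' ▸ hs))
        refine Set.notMem_empty t⁻¹ (this ▸ ⟨⟨g, hg, ?_⟩, Or.inr rfl⟩)
        rw [hts, conj_inv]
  · rintro (rfl | ⟨hS, rfl⟩)
    · exact Or.inl rfl
    · exact Or.inr ⟨1, Γ.one_mem, t, Or.inl hS, (one_smul _ _).symm, (one_smul _ _).symm⟩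

/-! ### Intermediate extensions and their kernels -/

namespace IntermediateExtension

theorem mk_eq_of_ρ_eq (E : IntermediateExtension T Γ) {x y : Boundary β} (h : E.ρ x = E.ρ y) :
    QuotientSpace.mk T Γ x = QuotientSpace.mk T Γ y := by
  rw [← E.comp_eq]
  exact congrArg E.ρ' h

/-- The fibre lies in the R_{T,Γ}-class {t^∞, t^{-∞}}, so it has two points exactly when these are
glued. -/
theorem mem_doublePoints_iff (hT : ∀ t ∈ T, Indivisible t)
    (hTconj : ∀ s ∈ T, ∀ t ∈ T, s ≠ t → conjClass Γ s ∩ {t, t⁻¹} = ∅)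
    (E : IntermediateExtension T Γ) {t : FreeGroup β} (ht : t ∈ T) :
    t ∈ E.doublePoints ↔ E.ρ (powLimit t) = E.ρ (powLimit t⁻¹) := by
  have hne := powLimit_ne_powLimit_inv (hT t ht).ne_one
  have hsub : E.ρ ⁻¹' {E.ρ (powLimit t)} ⊆ {powLimit t, powLimit t⁻¹} := by
    intro y hy
    have := (identRel_powLimit_iff hT hTconj subset_rfl ht).mp
      ((QuotientSpace.mk_eq_mk_iff hT).mp (E.mk_eq_of_ρ_eq (Eq.symm hy)))
    exact this.imp id And.right
  constructor
  · rintro ⟨-, h2⟩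
    have := Set.eq_of_subset_of_ncard_le hsub (by rw [h2, Set.ncard_pair hne])
    have hmem : powLimit t⁻¹ ∈ E.ρ ⁻¹' {E.ρ (powLimit t)} := by
      rw [this]
      exact Or.inr rfl
    exact Eq.symm hmem
  · intro h
    refine ⟨ht, ?_⟩
    rw [Set.Subset.antisymm hsub ?_, Set.ncard_pair hne]
    rintro y (rfl | rfl)
    · rfl
    · exact h.symm

theorem doublePoints_subset (E : IntermediateExtension T Γ) : E.doublePoints ⊆ T :=
  Set.sep_subset _ _

theorem ρ_eq_iff (hT : ∀ t ∈ T, Indivisible t)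
    (hTconj : ∀ s ∈ T, ∀ t ∈ T, s ≠ t → conjClass Γ s ∩ {t, t⁻¹} = ∅)
    (E : IntermediateExtension T Γ) {x y : Boundary β} :
    E.ρ x = E.ρ y ↔ IdentRel E.doublePoints Γ x y := by
  have hsmul : ∀ g ∈ Γ, ∀ x y, E.ρ (g • x) = E.ρ (g • y) ↔ E.ρ x = E.ρ y := by
    intro g hg x y
    have h := E.isFactorMap_ρ.map_smul ⟨g, hg⟩
    change E.ρ ((⟨g, hg⟩ : Γ) • x) = E.ρ ((⟨g, hg⟩ : Γ) • y) ↔ _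
    rw [h, h, smul_left_cancel_iff]
  constructor
  · intro h
    rcases (QuotientSpace.mk_eq_mk_iff hT).mp (E.mk_eq_of_ρ_eq h) with
      rfl | ⟨g, hg, t, ht, rfl, rfl⟩
    · exact Or.inl rfl
    · refine Or.inr ⟨g, hg, t, ?_, rfl, rfl⟩
      rw [hsmul g hg] at h
      rcases ht with ht | ht
      · exact Or.inl ((E.mem_doublePoints_iff hT hTconj ht).mpr h)
      · exact Or.inr ((E.mem_doublePoints_iff hT hTconj ht).mpr (by rw [inv_inv, h]))
  · rintro (rfl | ⟨g, hg, t, ht | ht, rfl, rfl⟩)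
    · rfl
    · rw [hsmul g hg]
      exact (E.mem_doublePoints_iff hT hTconj ht.1).mp ht
    · rw [hsmul g hg]
      have := (E.mem_doublePoints_iff hT hTconj ht.1).mp ht
      rw [inv_inv] at this
      exact this.symm

theorem doublePoints_ofSubset [Finite β] (hT : ∀ t ∈ T, Indivisible t)
    (hTconj : ∀ s ∈ T, ∀ t ∈ T, s ≠ t → conjClass Γ s ∩ {t, t⁻¹} = ∅) (hST : S ⊆ T)
    (hH : T2Space (QuotientSpace S Γ)) :
    (ofSubset (T := T) S hST hH).doublePoints = S := by
  have key : ∀ t ∈ T, t ∈ (ofSubset (T := T) S hST hH).doublePoints ↔ t ∈ S := by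
    intro t ht
    rw [mem_doublePoints_iff hT hTconj _ ht]
    change QuotientSpace.mk S Γ _ = QuotientSpace.mk S Γ _ ↔ _
    rw [QuotientSpace.mk_eq_mk_iff fun s hs => hT s (hST hs),
      identRel_powLimit_iff hT hTconj hST ht]
    simp [(powLimit_ne_powLimit_inv (hT t ht).ne_one).symm]
  ext t
  exact ⟨fun h => (key t (doublePoints_subset _ h)).mp h, fun h => (key t (hST h)).mpr h⟩

/-- Both spaces are the quotient of the boundary by the same kernel. Surjectivity of `ρ` then yields
equivariance and compatibility with `ρ'`. -/
theorem iso_of_ρ_eq_iff {E F : IntermediateExtension T Γ}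
    (h : ∀ x y, E.ρ x = E.ρ y ↔ F.ρ x = F.ρ y) : Iso E F := by
  have hE := E.isFactorMap_ρ.isQuotientMap
  have hF := F.isFactorMap_ρ.isQuotientMap
  let e : E.Z ≃ₜ F.Z :=
    { toFun := fun z => F.ρ (Function.surjInv hE.surjective z)
      invFun := fun z => E.ρ (Function.surjInv hF.surjective z)
      left_inv := fun z => by
        conv_rhs => rw [← Function.surjInv_eq hE.surjective z]
        exact (h _ _).mpr (Function.surjInv_eq hF.surjective _)
      right_inv := fun z => by
        conv_rhs => rw [← Function.surjInv_eq hF.surjective z]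
        exact (h _ _).mp (Function.surjInv_eq hE.surjective _)
      continuous_toFun := by
        refine hE.continuous_iff.mpr (hF.continuous.congr fun x => ?_)
        exact (h _ _).mp (Function.surjInv_eq hE.surjective _).symm
      continuous_invFun := by
        refine hF.continuous_iff.mpr (hE.continuous.congr fun x => ?_)
        exact (h _ _).mpr (Function.surjInv_eq hF.surjective _).symm }
  have he : ∀ x, e (E.ρ x) = F.ρ x := fun x =>
    (h _ _).mp (Function.surjInv_eq hE.surjective _)
  refine ⟨e, fun g z => ?_, funext he, funext fun z => ?_⟩
  · obtain ⟨x, rfl⟩ := hE.surjective z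
    rw [← E.isFactorMap_ρ.map_smul, he, he, F.isFactorMap_ρ.map_smul]
  · obtain ⟨x, rfl⟩ := hE.surjective z
    rw [Function.comp_apply, he]
    exact (congrFun F.comp_eq x).trans (congrFun E.comp_eq x).symm

theorem Iso.doublePoints_eq {E F : IntermediateExtension T Γ} (h : Iso E F) :
    E.doublePoints = F.doublePoints := by
  obtain ⟨e, -, he, -⟩ := h
  have : ∀ t, E.ρ ⁻¹' {E.ρ (powLimit t)} = F.ρ ⁻¹' {F.ρ (powLimit t)} := by
    intro t
    ext y
    simp [← he]
  simp only [doublePoints, this]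

end IntermediateExtension

end topology

end FreeGroupBoundary

theorem mainTheorem3 {α : Type*} [Finite α] [Nontrivial α]
    (Γ : Subgroup (FreeGroup α)) (hΓ : Γ.Normal) (hΓ1 : Γ ≠ ⊥)
    (T : Set (FreeGroup α))
    (hTind : ∀ t ∈ T, Indivisible t)
    (hTfin : {C : Set (FreeGroup α) | ∃ t ∈ T, C = conjClass ⊤ t}.Finite)
    (hTΓ : ∀ n : ℤ, n ≠ 0 → ∀ t ∈ T, t ^ n ∉ Γ)
    (hTconj : ∀ s ∈ T, ∀ t ∈ T, s ≠ t → conjClass Γ s ∩ {t, t⁻¹} = ∅) :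
    (∀ S ⊆ T, Equivalence (IdentRel S Γ)) ∧
    ∃ hH : ∀ S ⊆ T, T2Space (QuotientSpace S Γ),
    ∃ Φ : Quotient (IntermediateExtension.setoid T Γ) ≃ {S : Set (FreeGroup α) // S ⊆ T},
      (∀ E : IntermediateExtension T Γ, (Φ (Quotient.mk _ E)).1 = E.doublePoints) ∧
      ∀ S : {S : Set (FreeGroup α) // S ⊆ T},
        Φ.symm S = Quotient.mk _ (IntermediateExtension.ofSubset S.1 S.2 (hH S.1 S.2)) := by
  have hH : ∀ S ⊆ T, T2Space (QuotientSpace S Γ) := fun S hS =>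
    t2Space_quotientSpace (fun t ht => hTind t (hS ht))
      (hTfin.subset fun C ⟨t, ht, hC⟩ => ⟨t, hS ht, hC⟩)
  refine ⟨fun S hS => identRel_equivalence fun t ht => hTind t (hS ht), hH, ?_⟩
  let Φ : Quotient (IntermediateExtension.setoid T Γ) ≃ {S : Set (FreeGroup α) // S ⊆ T} :=
    { toFun := Quotient.lift (fun E => ⟨E.doublePoints, E.doublePoints_subset⟩)
        fun _ _ h => Subtype.ext (IntermediateExtension.Iso.doublePoints_eq h)
      invFun := fun S => Quotient.mk _ (IntermediateExtension.ofSubset S.1 S.2 (hH S.1 S.2))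
      left_inv := by
        intro q
        induction q using Quotient.ind with | _ E => ?_
        refine Quotient.sound (IntermediateExtension.iso_of_ρ_eq_iff fun x y => ?_)
        rw [E.ρ_eq_iff hTind hTconj]
        exact QuotientSpace.mk_eq_mk_iff fun t ht => hTind t (E.doublePoints_subset ht)
      right_inv := fun S =>
        Subtype.ext (IntermediateExtension.doublePoints_ofSubset hTind hTconj S.2 (hH S.1 S.2)) }
  exact ⟨Φ, fun _ => rfl, fun _ => rfl⟩
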